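/- Theorem. Let $H$ be a complex separable infinite-dimensional Hilbert space, let $B(H)$ be the set of all bounded linear operators $H \to H$, and let $\mathcal{CR}(H)$ be the set of all $A \in B(H)$ whose range $A(H)$ is closed in $H$. Then $\mathcal{CR}(H)$ is a Borel subset of $B(H)$ with respect to the weak operator topology, that is, it belongs to the $\sigma$-algebra generated by the sets that are open in the weak operator topology. Hence $\mathcal{CR}(H)$ is also a Borel subset of $B(H)$ with respect to the operator norm topology. -/

import Mathlib

/-- The set of all bounded linear operators on `H` whose range is closed in (the norm topology
of) `H`. -/
def closedRangeOperators (H : Type*) [NormedAddCommGroup H] [InnerProductSpace ℂ H] :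
    Set (H →L[ℂ] H) :=
  {A | IsClosed (Set.range A)}

/-- A set of bounded operators is WOT-Borel if it belongs to the σ-algebra generated by the sets
that are open in the weak operator topology. `H →WOT[ℂ] H` is the copy of `H →L[ℂ] H` which carries
that topology, and `toCLM` is the identification of the copy with `H →L[ℂ] H`. -/
def IsWOTBorel {H : Type*} [NormedAddCommGroup H] [InnerProductSpace ℂ H]
    (S : Set (H →L[ℂ] H)) : Prop :=
  @MeasurableSet (H →WOT[ℂ] H) (borel (H →WOT[ℂ] H))
    ((ContinuousLinearMapWOT.toCLM : (H →WOT[ℂ] H) → _) ⁻¹' S)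

/-- A set of bounded operators is norm-Borel if it belongs to the σ-algebra generated by the sets
that are open in the operator norm topology. -/
def IsNormBorel {H : Type*} [NormedAddCommGroup H] [InnerProductSpace ℂ H]
    (S : Set (H →L[ℂ] H)) : Prop :=
  @MeasurableSet (H →L[ℂ] H) (borel (H →L[ℂ] H)) S

/-!
For a bounded operator `A` on a Hilbert space, the range of `A` is closed if and only if
`‖A† y‖ ≤ c * ‖A (A† y)‖` for some constant `c` and all `y`: both say that `A` is bounded below on
`(ker A)ᗮ = closure (range A†)` (`ContinuousLinearMap.isClosed_range_iff_exists_norm_adjoint_le`).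
Both sides of the inequality are continuous in `y`, so on a separable space it is enough to test it
for natural numbers `c` and for `y` in a countable dense set, which exhibits the set of operators
with closed range as a countable union of countable intersections of sets
`{A | ‖A† y‖ ≤ c * ‖A (A† y)‖}`.

Each of these sets is WOT-Borel. The norm of a vector `v` is determined by countably many of the
numbers `⟪d, v⟫`, so a weakly measurable function into a separable space has a measurable norm
(`measurable_norm_of_forall_measurable_inner`), and, by polarization, the inner product of two such
functions is measurable. Now `⟪d, A† y⟫ = ⟪A d, y⟫` is WOT-continuous in `A`, hence `A ↦ A† y` is
weakly measurable, and so is `A ↦ A (A† y)`, because `⟪d, A (A† y)⟫ = ⟪A† d, A† y⟫`.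
-/

section WeakMeasurability

variable {𝕜 E α : Type*} [RCLike 𝕜] [NormedAddCommGroup E] [InnerProductSpace 𝕜 E]

/-- The norm of a vector is tested against the inner products with the vectors of a dense
sequence. -/
theorem norm_le_iff_forall_norm_inner_denseSeq_le [TopologicalSpace.SeparableSpace E]
    (v : E) {r : ℝ} (hr : 0 ≤ r) :
    ‖v‖ ≤ r ↔ ∀ n, ‖inner 𝕜 (TopologicalSpace.denseSeq E n) v‖ ≤
      r * ‖TopologicalSpace.denseSeq E n‖ := by
  constructor
  · intro h n
    calc ‖inner 𝕜 (TopologicalSpace.denseSeq E n) v‖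
        ≤ ‖TopologicalSpace.denseSeq E n‖ * ‖v‖ := norm_inner_le_norm _ _
      _ ≤ ‖TopologicalSpace.denseSeq E n‖ * r := by gcongr
      _ = r * ‖TopologicalSpace.denseSeq E n‖ := mul_comm _ _
  · intro h
    have key : ∀ d : E, ‖inner 𝕜 d v‖ ≤ r * ‖d‖ := fun d =>
      (TopologicalSpace.denseRange_denseSeq E).induction_on
        (p := fun d : E => ‖inner 𝕜 d v‖ ≤ r * ‖d‖) d
        (isClosed_le (by fun_prop) (by fun_prop)) h
    rcases eq_or_ne v 0 with rfl | hv
    · simpa using hr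
    · have h1 : ‖v‖ * ‖v‖ ≤ r * ‖v‖ := by
        rw [← inner_self_eq_norm_mul_norm (𝕜 := 𝕜) v, inner_self_re_eq_norm]
        exact key v
      exact le_of_mul_le_mul_right h1 (norm_pos_iff.mpr hv)

variable [MeasurableSpace α] [TopologicalSpace.SeparableSpace E]

theorem measurable_norm_of_forall_measurable_inner {f : α → E}
    (hf : ∀ d, Measurable fun a => inner 𝕜 d (f a)) : Measurable fun a => ‖f a‖ := by
  refine measurable_of_Iic fun r => ?_
  rcases lt_or_ge r 0 with hr | hr
  · convert! MeasurableSet.empty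
    ext a
    simpa using hr.trans_le (norm_nonneg (f a))
  · have : (fun a => ‖f a‖) ⁻¹' Set.Iic r =
        ⋂ n, {a | ‖inner 𝕜 (TopologicalSpace.denseSeq E n) (f a)‖ ≤
          r * ‖TopologicalSpace.denseSeq E n‖} := by
      ext a
      simpa using norm_le_iff_forall_norm_inner_denseSeq_le (𝕜 := 𝕜) (f a) hr
    rw [this]
    exact MeasurableSet.iInter fun n => measurableSet_le (hf _).norm measurable_const

theorem measurable_inner_of_forall_measurable_inner {f g : α → E}
    (hf : ∀ d, Measurable fun a => inner 𝕜 d (f a))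
    (hg : ∀ d, Measurable fun a => inner 𝕜 d (g a)) :
    Measurable fun a => inner 𝕜 (f a) (g a) := by
  have hn : ∀ c : 𝕜, Measurable fun a => ‖f a + c • g a‖ := fun c =>
    measurable_norm_of_forall_measurable_inner (𝕜 := 𝕜) fun d => by
      simp only [inner_add_right, inner_smul_right]
      exact (hf d).add ((hg d).const_mul c)
  have h1 := RCLike.measurable_ofReal (𝕜 := 𝕜) |>.comp (hn 1)
  have h2 := RCLike.measurable_ofReal (𝕜 := 𝕜) |>.comp (hn (-1))
  have h3 := RCLike.measurable_ofReal (𝕜 := 𝕜) |>.comp (hn (-RCLike.I))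
  have h4 := RCLike.measurable_ofReal (𝕜 := 𝕜) |>.comp (hn RCLike.I)
  simp only [neg_smul, one_smul, ← sub_eq_add_neg, Function.comp_def] at h1 h2 h3 h4
  simp only [inner_eq_sum_norm_sq_div_four]
  exact (((h1.pow_const 2).sub (h2.pow_const 2)).add
    (((h3.pow_const 2).sub (h4.pow_const 2)).mul_const _)).div_const _

end WeakMeasurability

section ClosedRange

variable {𝕜 E F : Type*} [RCLike 𝕜] [NormedAddCommGroup E] [InnerProductSpace 𝕜 E]
  [CompleteSpace E] [NormedAddCommGroup F] [InnerProductSpace 𝕜 F] [CompleteSpace F]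

open ContinuousLinearMap (adjoint)

/-- By the open mapping theorem, vectors of a closed range have preimages of controlled norm. -/
theorem ContinuousLinearMap.exists_norm_adjoint_le_of_isClosed_range (A : E →L[𝕜] F)
    (hA : IsClosed (Set.range A)) : ∃ c : ℝ, ∀ y, ‖adjoint A y‖ ≤ c * ‖A (adjoint A y)‖ := by
  have hA' : IsClosed (A.range : Set F) := by
    rwa [LinearMap.coe_range]
  have : CompleteSpace A.range := hA'.completeSpace_coe
  obtain ⟨C, -, hC⟩ := A.rangeRestrict.exists_preimage_norm_le
    (by rintro ⟨_, x, rfl⟩; exact ⟨x, rfl⟩)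
  refine ⟨C, fun y => ?_⟩
  obtain ⟨x, hx, hxC⟩ := hC ⟨A (adjoint A y), _, rfl⟩
  replace hx : A x = A (adjoint A y) := congrArg Subtype.val hx
  replace hxC : ‖x‖ ≤ C * ‖A (adjoint A y)‖ := hxC
  -- `x - A† y` lies in `ker A`, which is orthogonal to `A† y`
  have h : inner 𝕜 (adjoint A y) (adjoint A y) = inner 𝕜 x (adjoint A y) := by
    rw [adjoint_inner_right, adjoint_inner_right, hx]
  have h1 : ‖adjoint A y‖ * ‖adjoint A y‖ ≤ ‖x‖ * ‖adjoint A y‖ := by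
    rw [← inner_self_eq_norm_mul_norm (𝕜 := 𝕜) (adjoint A y), inner_self_re_eq_norm, h]
    exact norm_inner_le_norm _ _
  rcases (norm_nonneg (adjoint A y)).eq_or_lt with h0 | h0
  · rw [← h0]
    exact (norm_nonneg x).trans hxC
  · exact (le_of_mul_le_mul_right h1 h0).trans hxC

/-- The bound passes to `closure (range A†) = (ker A)ᗮ`, on which `A` is therefore antilipschitz,
and the image of `(ker A)ᗮ` is all of the range of `A`. -/
theorem ContinuousLinearMap.isClosed_range_of_norm_adjoint_le (A : E →L[𝕜] F) {c : ℝ}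
    (hc : ∀ y, ‖adjoint A y‖ ≤ c * ‖A (adjoint A y)‖) : IsClosed (Set.range A) := by
  have hK : ∀ x ∈ A.kerᗮ, ‖x‖ ≤ c * ‖A x‖ := by
    intro x hx
    rw [ContinuousLinearMap.orthogonal_ker] at hx
    refine closure_minimal (t := {x | ‖x‖ ≤ c * ‖A x‖}) ?_
      (isClosed_le (by fun_prop) (by fun_prop)) hx
    rintro _ ⟨y, rfl⟩
    exact hc y
  let g : A.kerᗮ →L[𝕜] F := A ∘L A.kerᗮ.subtypeL
  have hg : AntilipschitzWith c.toNNReal g := by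
    refine g.antilipschitz_of_bound fun x => (hK x x.2).trans ?_
    exact mul_le_mul_of_nonneg_right (Real.le_coe_toNNReal c) (norm_nonneg _)
  have hr : Set.range A = Set.range g := by
    refine Set.Subset.antisymm ?_ ?_
    · rintro _ ⟨x, rfl⟩
      have : CompleteSpace A.ker := A.isClosed_ker.completeSpace_coe
      refine ⟨⟨x - A.ker.starProjection x, A.ker.sub_starProjection_mem_orthogonal x⟩, ?_⟩
      have h0 : A (A.ker.starProjection x) = 0 := A.ker.starProjection_apply_mem x
      simp [g, h0]
    · rintro _ ⟨x, rfl⟩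
      exact ⟨x, rfl⟩
  rw [hr]
  exact hg.isClosed_range g.uniformContinuous

theorem ContinuousLinearMap.isClosed_range_iff_exists_norm_adjoint_le (A : E →L[𝕜] F) :
    IsClosed (Set.range A) ↔ ∃ c : ℝ, ∀ y, ‖adjoint A y‖ ≤ c * ‖A (adjoint A y)‖ :=
  ⟨A.exists_norm_adjoint_le_of_isClosed_range, fun ⟨_, hc⟩ =>
    A.isClosed_range_of_norm_adjoint_le hc⟩

/-- On a separable space, the criterion for a closed range consists of countably many
conditions. -/
theorem ContinuousLinearMap.isClosed_range_iff_exists_nat_forall_denseSeq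
    [TopologicalSpace.SeparableSpace F] (A : E →L[𝕜] F) :
    IsClosed (Set.range A) ↔ ∃ n : ℕ, ∀ m : ℕ,
      ‖adjoint A (TopologicalSpace.denseSeq F m)‖ ≤
        n * ‖A (adjoint A (TopologicalSpace.denseSeq F m))‖ := by
  rw [A.isClosed_range_iff_exists_norm_adjoint_le]
  constructor
  · rintro ⟨c, hc⟩
    obtain ⟨n, hn⟩ := exists_nat_ge c
    exact ⟨n, fun m => (hc _).trans (by gcongr)⟩
  · rintro ⟨n, hn⟩
    exact ⟨n, fun y => (TopologicalSpace.denseRange_denseSeq F).induction_on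
      (p := fun y : F => ‖adjoint A y‖ ≤ n * ‖A (adjoint A y)‖) y
      (isClosed_le (by fun_prop) (by fun_prop)) hn⟩

end ClosedRange

section WeakOperatorTopology

variable {H : Type*} [NormedAddCommGroup H] [InnerProductSpace ℂ H]

theorem IsWOTBorel.isNormBorel {S : Set (H →L[ℂ] H)} (hS : IsWOTBorel S) : IsNormBorel S :=
  (ContinuousLinearMapWOT.continuous_ofCLM
    (σ := RingHom.id ℂ) (E := H) (F := H)).borel_measurable hS

variable [CompleteSpace H] [TopologicalSpace.SeparableSpace H]

open ContinuousLinearMap (adjoint)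

theorem isWOTBorel_closedRangeOperators : IsWOTBorel (closedRangeOperators H) := by
  let _ : MeasurableSpace (H →WOT[ℂ] H) := borel _
  have : BorelSpace (H →WOT[ℂ] H) := ⟨rfl⟩
  have h1 : ∀ y d : H, Measurable fun A : H →WOT[ℂ] H => inner ℂ d (adjoint A.toCLM y) := by
    intro y d
    have hc : Continuous fun A : H →WOT[ℂ] H => inner ℂ y (A d) :=
      ContinuousLinearMapWOT.continuous_inner_apply continuous_id d y
    have hm := (Complex.continuous_conj.comp hc).measurable
    convert! hm using 2 with A
    simp [ContinuousLinearMap.adjoint_inner_right]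
  have h2 : ∀ y d : H, Measurable fun A : H →WOT[ℂ] H =>
      inner ℂ d (A.toCLM (adjoint A.toCLM y)) := by
    intro y d
    simp only [← ContinuousLinearMap.adjoint_inner_left _ (adjoint _ y) d]
    exact measurable_inner_of_forall_measurable_inner (h1 d) (h1 y)
  have hset : (ContinuousLinearMapWOT.toCLM : (H →WOT[ℂ] H) → _) ⁻¹' closedRangeOperators H =
      ⋃ n : ℕ, ⋂ m : ℕ, {A | ‖adjoint A.toCLM (TopologicalSpace.denseSeq H m)‖ ≤
        n * ‖A.toCLM (adjoint A.toCLM (TopologicalSpace.denseSeq H m))‖} := by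
    ext A
    simpa [closedRangeOperators] using
      A.toCLM.isClosed_range_iff_exists_nat_forall_denseSeq
  rw [IsWOTBorel, hset]
  exact MeasurableSet.iUnion fun n => MeasurableSet.iInter fun m => measurableSet_le
    (measurable_norm_of_forall_measurable_inner (h1 _))
    ((measurable_norm_of_forall_measurable_inner (h2 _)).const_mul _)

end WeakOperatorTopology

theorem mainTheorem4 (H : Type*) [NormedAddCommGroup H] [InnerProductSpace ℂ H] [CompleteSpace H]
    [TopologicalSpace.SeparableSpace H] (hdim : ¬ FiniteDimensional ℂ H) :
    IsWOTBorel (closedRangeOperators H) ∧ IsNormBorel (closedRangeOperators H) :=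
  ⟨isWOTBorel_closedRangeOperators, isWOTBorel_closedRangeOperators.isNormBorel⟩
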